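/- Let $\lambda$ be a partition, viewed as a Young diagram. A filling of $\lambda$ assigns positive integers to the boxes such that no integer is skipped. An inverted semistandard Young tableau of shape $\lambda$ is a filling $\tau$ whose rows are strictly increasing from left to right. Its standardization $\mathrm{st}(\tau)$ is the semistandard Young tableau (rows strictly increasing, columns weakly increasing) obtained by reordering each column of $\tau$ independently. For two boxes $x,y$ in the same column of $\tau$, let $x_k,y_k$ denote the entries of $\tau$ exactly $k$ boxes to the right of $x,y$. The entries in $x,y$ form an inversion pair $(x,y)$ if the entry in $x$ is smaller than the entry in $y$ and, for some $n\ge 0$, the entries $x_k,y_k$ exist and are equal for $1\le k\le n$, and either ($x_{n+1}$ or $y_{n+1}$ does not exist and $x$ lies below $y$) or ($x_{n+1},y_{n+1}$ both exist and $x_{n+1}>y_{n+1}$). The height order $\blacktriangleleft$ on the boxes of a column of $\tau$ is defined from the rightmost column to the left: if $x$ or $y$ has no right neighbour, then $x\blacktriangleleft y$ when $x$ lies above $y$; if both have right neighbours $x',y'$, then $x\blacktriangleleft y$ when the entry in $x'$ is smaller than that in $y'$, or these entries are equal and $x'\blacktriangleleft y'$. An identification of the entries of $\tau$ with those of $\mathrm{st}(\tau)$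 is a bijection from the boxes of $\tau$ to the boxes of $\mathrm{st}(\tau)$ which preserves columns and entries. Given an identification, the collection of entry-specific inversion pairs of $\tau$ is the set of pairs of boxes of $\mathrm{st}(\tau)$ that correspond to the inversion pairs of $\tau$. Two identifications are distinguished: the $k$-th copy of a value in a column of $\tau$ is sent to the $k$-th copy from the top of that value in the same column of $\mathrm{st}(\tau)$, where the copies in $\tau$ are counted (a) from top to bottom, or (b) in the height order. **Proposition.** An inverted semistandard Young tableau $\tau$ is uniquely determined by its standardization $T=\mathrm{st}(\tau)$ together with its collection of entry-specific inversion pairs. That is, if $\tau,\tau'$ are inverted semistandard Young tableaux of shape $\lambda$ with $\mathrm{st}(\tau)=\mathrm{st}(\tau')$, then $\tau=\tau'$ as soon as their collections of entry-specific inversion pairs coincide, where these are formed for both tableaux with identification (a), or for both with identification (b), or, more generally, with an arbitrary identification for $\tau$ and an arbitrary identification for $\tau'$. -/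

import Mathlib

/- Cells of a Young diagram are pairs `(row, column)`, both counted from `0`. -/
namespace YoungInversion

/-- A filling of a Young diagram `lam`: positive integers in the boxes, no integer being skipped.
For extensionality the entry function is `0` outside `lam`. -/
structure Filling (lam : YoungDiagram) where
  entry : ℕ → ℕ → ℕ
  pos : ∀ i j, (i, j) ∈ lam → 0 < entry i j
  zeros : ∀ i j, (i, j) ∉ lam → entry i j = 0
  no_skip : ∀ i j, (i, j) ∈ lam → ∀ v, 0 < v → v ≤ entry i j →
    ∃ i' j', (i', j') ∈ lam ∧ entry i' j' = v

/-- An inverted semistandard Young tableau of shape `lam`: a filling that is row-standard, i.e.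
strictly increasing along each row. Its content is arbitrary, so this type is the union over all
contents `mu` of the sets `I(lam, mu)`. -/
structure InvertedTableau (lam : YoungDiagram) extends Filling lam where
  row_strict : ∀ i j₁ j₂, j₁ < j₂ → (i, j₂) ∈ lam → entry i j₁ < entry i j₂

/-- A semistandard Young tableau (rows strictly increasing, columns weakly increasing). -/
structure SemistandardTableau (lam : YoungDiagram) extends InvertedTableau lam where
  col_weak : ∀ i₁ i₂ j, i₁ ≤ i₂ → (i₂, j) ∈ lam → entry i₁ j ≤ entry i₂ j

namespace InvertedTableau

variable {lam : YoungDiagram} (τ : InvertedTableau lam)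

/-- The `c`-th column, read from top to bottom. -/
def column (c : ℕ) : Fin (lam.colLen c) → ℕ := fun r => τ.entry r c

/-- The entry in row `r` and column `c` after each column has been sorted (weakly increasingly from
top to bottom). -/
def sortedEntry (r c : ℕ) : ℕ :=
  if h : r < lam.colLen c then τ.column c (Tuple.sort (τ.column c) ⟨r, h⟩) else 0

theorem sortedEntry_of_lt {r c : ℕ} (h : r < lam.colLen c) :
    τ.sortedEntry r c = τ.column c (Tuple.sort (τ.column c) ⟨r, h⟩) := dif_pos h

theorem exists_sortedEntry {r c : ℕ} (h : (r, c) ∈ lam) :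
    ∃ r', (r', c) ∈ lam ∧ τ.sortedEntry r c = τ.entry r' c := by
  have h' := YoungDiagram.mem_iff_lt_colLen.1 h
  refine ⟨Tuple.sort (τ.column c) ⟨r, h'⟩, ?_, τ.sortedEntry_of_lt h'⟩
  exact YoungDiagram.mem_iff_lt_colLen.2 (Fin.isLt _)

theorem exists_eq_sortedEntry {r c : ℕ} (h : (r, c) ∈ lam) :
    ∃ r', (r', c) ∈ lam ∧ τ.sortedEntry r' c = τ.entry r c := by
  have h' := YoungDiagram.mem_iff_lt_colLen.1 h
  refine ⟨(Tuple.sort (τ.column c)).symm ⟨r, h'⟩,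
    YoungDiagram.mem_iff_lt_colLen.2 (Fin.isLt _), ?_⟩
  rw [τ.sortedEntry_of_lt (Fin.isLt _)]
  simp [column]

theorem sortedEntry_mono {r s c : ℕ} (hrs : r ≤ s) (h : (s, c) ∈ lam) :
    τ.sortedEntry r c ≤ τ.sortedEntry s c := by
  have h' := YoungDiagram.mem_iff_lt_colLen.1 h
  rw [τ.sortedEntry_of_lt h', τ.sortedEntry_of_lt (hrs.trans_lt h')]
  exact Tuple.monotone_sort (τ.column c) (show (⟨r, _⟩ : Fin _) ≤ ⟨s, h'⟩ from hrs)

theorem sortedEntry_row_strict {r c d : ℕ} (hcd : c < d) (h : (r, d) ∈ lam) :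
    τ.sortedEntry r c < τ.sortedEntry r d := by
  have hd := YoungDiagram.mem_iff_lt_colLen.1 h
  have hle : lam.colLen d ≤ lam.colLen c := lam.colLen_anti c d hcd.le
  have hc := hd.trans_le hle
  rw [τ.sortedEntry_of_lt hc, τ.sortedEntry_of_lt hd]
  by_contra! hlt
  let g : Fin (r + 1) → Fin (lam.colLen c) := fun k =>
    (Tuple.sort (τ.column c)).symm
      (Fin.castLE hle (Tuple.sort (τ.column d) ⟨k, lt_of_lt_of_le k.2 hd⟩))
  have hg : Function.Injective g := by
    intro k l hkl
    have := Fin.castLE_injective hle ((Tuple.sort (τ.column c)).symm.injective hkl)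
    have := (Tuple.sort (τ.column d)).injective this
    simpa [Fin.ext_iff] using this
  have hlt' : ∀ k, (g k : ℕ) < r := by
    intro k
    by_contra! hk
    have h1 := Tuple.monotone_sort (τ.column c) (show (⟨r, hc⟩ : Fin _) ≤ g k from hk)
    have h2 := Tuple.monotone_sort (τ.column d)
      (show (⟨k, lt_of_lt_of_le k.2 hd⟩ : Fin _) ≤ ⟨r, hd⟩ from Nat.lt_succ_iff.1 k.2)
    have h3 := τ.row_strict (Tuple.sort (τ.column d) ⟨k, lt_of_lt_of_le k.2 hd⟩) c d hcd
      (YoungDiagram.mem_iff_lt_colLen.2 (Fin.isLt _))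
    simp only [Function.comp_apply, g, Equiv.apply_symm_apply] at h1 h2
    simp only [column, Fin.val_castLE] at h1 h2 hlt
    omega
  have := Fintype.card_le_of_injective (fun k => (⟨g k, hlt' k⟩ : Fin r))
    (fun k l hkl => hg (Fin.ext (by simpa using hkl)))
  simp at this

/-- The standardization `st(τ)`: the semistandard Young tableau obtained by reordering each column
of `τ` independently. -/
def st : SemistandardTableau lam where
  entry := τ.sortedEntry
  pos i j h := by
    obtain ⟨i', h', e⟩ := τ.exists_sortedEntry h
    exact e ▸ τ.pos i' j h'
  zeros i j h := dif_neg fun h' => h (YoungDiagram.mem_iff_lt_colLen.2 h')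
  no_skip i j h v hv hle := by
    obtain ⟨i', h', e⟩ := τ.exists_sortedEntry h
    obtain ⟨i₁, j₁, h₁, e₁⟩ := τ.no_skip i' j h' v hv (e ▸ hle)
    obtain ⟨i₂, h₂, e₂⟩ := τ.exists_eq_sortedEntry h₁
    exact ⟨i₂, j₁, h₂, e₂.trans e₁⟩
  row_strict _ _ _ hlt h := τ.sortedEntry_row_strict hlt h
  col_weak _ _ _ hle h := τ.sortedEntry_mono hle h

/-- The entries of `τ` in rows `r` and `s` of column `c` form (in this order) an inversion pair:
the first is smaller than the second, the entries `k` boxes to their right exist and agree for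
`1 ≤ k ≤ n`, and either one of the entries `n + 1` boxes to their right is missing and the first
entry lies below the second, or both exist and the first of them is the larger one.
(The case `n = 0` is the one in which the columns `c` and `c + 1` alone decide.) -/
def IsInversionPair (c r s : ℕ) : Prop :=
  (r, c) ∈ lam ∧ (s, c) ∈ lam ∧ τ.entry r c < τ.entry s c ∧
  ∃ n : ℕ,
    (∀ k, 1 ≤ k → k ≤ n →
      (r, c + k) ∈ lam ∧ (s, c + k) ∈ lam ∧ τ.entry r (c + k) = τ.entry s (c + k)) ∧
    ((((r, c + (n + 1)) ∉ lam ∨ (s, c + (n + 1)) ∉ lam) ∧ s < r) ∨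
     ((r, c + (n + 1)) ∈ lam ∧ (s, c + (n + 1)) ∈ lam ∧
        τ.entry s (c + (n + 1)) < τ.entry r (c + (n + 1))))

/-- The height order on column `c`: `HeightLT c r s` says that the entry in row `r` strictly
precedes the entry in row `s`. It is computed column by column from right to left. -/
inductive HeightLT : ℕ → ℕ → ℕ → Prop
  | missing {c r s : ℕ} (hr : (r, c) ∈ lam) (hs : (s, c) ∈ lam)
      (h : (r, c + 1) ∉ lam ∨ (s, c + 1) ∉ lam) (hrs : r < s) : HeightLT c r s
  | right_lt {c r s : ℕ} (hr : (r, c + 1) ∈ lam) (hs : (s, c + 1) ∈ lam)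
      (h : τ.entry r (c + 1) < τ.entry s (c + 1)) : HeightLT c r s
  | right_eq {c r s : ℕ} (hr : (r, c + 1) ∈ lam) (hs : (s, c + 1) ∈ lam)
      (h : τ.entry r (c + 1) = τ.entry s (c + 1)) (hrs : HeightLT (c + 1) r s) : HeightLT c r s

/-- An identification of the entries of `τ` with those of `st(τ)`: in each column `c`, the map
`φ c` is a bijection from the rows of `τ` to the rows of `st(τ)` that respects the values. -/
def IsIdentification (φ : ℕ → ℕ → ℕ) : Prop :=
  ∀ c, Set.BijOn (φ c) {r | (r, c) ∈ lam} {r | (r, c) ∈ lam} ∧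
    ∀ r, (r, c) ∈ lam → τ.st.entry (φ c r) c = τ.entry r c

/-- The row of `st(τ)` holding the entry in row `r` and column `c` of `τ`, if equal entries of a
column are told apart by their order from top to bottom: the `k`-th copy of a value in column `c`
of `τ` (from the top) goes to the `k`-th copy of this value in column `c` of `st(τ)`. -/
def readingIdentification (c r : ℕ) : ℕ :=
  ((Finset.range (lam.colLen c)).filter fun x =>
    τ.entry x c < τ.entry r c ∨ (τ.entry x c = τ.entry r c ∧ x < r)).card

open Classical in
/-- The same with equal entries of a column told apart by the height order of `τ`: the `k`-th copy
of a value in column `c` of `τ`, in height order, goes to the `k`-th copy of this value in column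
`c` of `st(τ)`. (In `st(τ)` the height order is the order from top to bottom.) -/
noncomputable def heightIdentification (c r : ℕ) : ℕ :=
  ((Finset.range (lam.colLen c)).filter fun x =>
    τ.entry x c < τ.entry r c ∨ (τ.entry x c = τ.entry r c ∧ τ.HeightLT c x r)).card

/-- The collection of entry-specific inversion pairs of `τ`, recorded as pairs of boxes of `st(τ)`
by means of the identification `φ`. -/
def entryInversions (φ : ℕ → ℕ → ℕ) : Set ((ℕ × ℕ) × (ℕ × ℕ)) :=
  {p | ∃ c r s, τ.IsInversionPair c r s ∧ p = ((φ c r, c), (φ c s, c))}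

end InvertedTableau

end YoungInversion

/-! ### Words matched by a permutation -/

namespace YoungInversion

/-! The columns of `τ` can be recovered from right to left. An inversion pair is a pair of entries
whose height order is opposite to their value order (`isInversionPair_iff`), and the height order on
a column sees only the columns to its right (`HeightLT.of_entry_eq`). Once those are known, the
column read in height order is a word, and the inversion pairs say which of any two letters with
distinct values comes first.

Two identifications with the same boxes of `st(τ)` give a value-preserving permutation between the
two words, which respects the order of distinct values but may permute equal letters. Pigeonhole at
the first disagreement shows that the words are equal (`eq_of_perm_of_forall_lt_iff`). Nothing else
about the identifications matters, so (a) and (b) are covered as soon as ranking is known to give an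
identification. -/

theorem not_mapsTo_diff_singleton {α : Type*} [Finite α] {u : α → α} (hu : Function.Injective u)
    {T : Set α} {x : α} (hx : x ∈ T) (h : ∀ b ∈ T, u b ∈ T ∧ u b ≠ x) : False := by
  have hb : Set.BijOn u T T :=
    (Set.Finite.injOn_iff_bijOn_of_mapsTo T.toFinite fun b hb => (h b hb).1).1 hu.injOn
  obtain ⟨b, hb, e⟩ := hb.surjOn hx
  exact (h b hb).2 e

/-- Two words whose letters are matched by a permutation that preserves values and the relative
order of any two letters with distinct values are equal. -/
theorem eq_of_perm_of_forall_lt_iff {α β : Type*} [Finite α] [LinearOrder α] [LinearOrder β]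
    {f g : α → β} (θ : Equiv.Perm α) (hθ : ∀ a, g (θ a) = f a)
    (h : ∀ a b, f a < f b → (b < a ↔ θ b < θ a)) : f = g := by
  have h' : ∀ a b, f a ≠ f b → θ a < θ b → a < b := by
    intro a b hab hlt
    rcases lt_or_gt_of_ne hab with hl | hl
    · by_contra! hba
      have hne : b ≠ a := fun e => hab (e ▸ rfl)
      exact lt_asymm hlt ((h a b hl).1 (lt_of_le_of_ne hba hne))
    · exact (h b a hl).2 hlt
  funext x
  induction x using WellFoundedLT.induction with
  | ind x ih =>
    by_contra hx
    -- Otherwise `θ` would send all positions up to `x` with `f`-value `f x` strictly below `x`,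
    -- hence, as `f` and `g` agree there, injectively into the same finite set without `x`.
    obtain ⟨a, hax, hfa, hxa⟩ : ∃ a, a ≤ x ∧ f a = f x ∧ x ≤ θ a := by
      by_contra! hno
      refine not_mapsTo_diff_singleton θ.injective (T := {a | a ≤ x ∧ f a = f x}) (x := x)
        ⟨le_rfl, rfl⟩ ?_
      rintro a ⟨ha, hfa⟩
      have hlt := hno a ha hfa
      exact ⟨⟨hlt.le, by rw [ih _ hlt, hθ, hfa]⟩, hlt.ne⟩
    have hxa : x < θ a := lt_of_le_of_ne hxa fun e => hx (by rw [← hfa, ← hθ a, ← e])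
    refine not_mapsTo_diff_singleton θ.symm.injective (T := {b | b ≤ x ∧ g b = g x}) (x := x)
      ⟨le_rfl, rfl⟩ ?_
    rintro b ⟨hb, hgb⟩
    have hfb : f (θ.symm b) = g x := by rw [← hθ, Equiv.apply_symm_apply, hgb]
    -- Since `b ≤ x < θ a` and the values differ, `θ.symm b` precedes `a`. So `θ.symm` maps the
    -- positions up to `x` with `g`-value `g x` into themselves and misses `x`, the same
    -- contradiction.
    have hlt : θ.symm b < x := by
      refine lt_of_lt_of_le (h' _ a ?_ ?_) hax
      · rw [hfb, hfa]
        exact Ne.symm hx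
      · rw [Equiv.apply_symm_apply]
        exact hb.trans_lt hxa
    exact ⟨⟨hlt.le, by rw [← ih _ hlt, hfb]⟩, hlt.ne⟩

namespace InvertedTableau

variable {lam : YoungDiagram}

theorem ext_entry {τ τ' : InvertedTableau lam} (h : ∀ r c, τ.entry r c = τ'.entry r c) :
    τ = τ' := by
  have h' : τ.entry = τ'.entry := funext fun r => funext fun c => h r c
  rcases τ with ⟨⟨e, _, _, _⟩, _⟩
  rcases τ' with ⟨⟨e', _, _, _⟩, _⟩
  simp only at h'
  subst h'
  rfl

variable (τ : InvertedTableau lam)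

theorem mem_of_mem_succ {r c : ℕ} (h : (r, c + 1) ∈ lam) : (r, c) ∈ lam :=
  lam.up_left_mem le_rfl (Nat.le_succ c) h

theorem row_lt_of_mem_of_notMem {r s c : ℕ} (hr : (r, c) ∈ lam) (hs : (s, c) ∉ lam) : r < s := by
  by_contra! h
  exact hs (lam.up_left_mem h le_rfl hr)

theorem exists_le_add_of_mem (lam : YoungDiagram) (c : ℕ) :
    ∃ n, ∀ r c', c + n ≤ c' → (r, c') ∉ lam := by
  refine ⟨lam.rowLen 0, fun r c' hc h => ?_⟩
  have := YoungDiagram.mem_iff_lt_rowLen.1 (lam.up_left_mem (Nat.zero_le r) le_rfl h)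
  omega

/-! ### The height order as a strict total order -/

namespace HeightLT

variable {τ} {c r s t : ℕ}

theorem mem_left (h : τ.HeightLT c r s) : (r, c) ∈ lam := by
  cases h with
  | missing hr hs h hrs => exact hr
  | right_lt hr hs h => exact mem_of_mem_succ hr
  | right_eq hr hs h hrs => exact mem_of_mem_succ hr

theorem mem_right (h : τ.HeightLT c r s) : (s, c) ∈ lam := by
  cases h with
  | missing hr hs h hrs => exact hs
  | right_lt hr hs h => exact mem_of_mem_succ hs
  | right_eq hr hs h hrs => exact mem_of_mem_succ hs

theorem ne (h : τ.HeightLT c r s) : r ≠ s := by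
  induction h with
  | missing hr hs h hrs => exact hrs.ne
  | right_lt hr hs h =>
    rintro rfl
    exact lt_irrefl _ h
  | right_eq hr hs h hrs ih => exact ih

theorem trans (h : τ.HeightLT c r s) (h' : τ.HeightLT c s t) : τ.HeightLT c r t := by
  induction h with
  | missing hr hs h hrs =>
    -- Row lengths decrease downwards: if the upper row `r` stops at column `c`, so does `s`.
    have hs' := h.elim (fun h hs => h (lam.up_left_mem hrs.le le_rfl hs)) id
    cases h' with
    | missing _ ht h' hst =>
      exact .missing hr ht (.inr fun ht => hs' (lam.up_left_mem hst.le le_rfl ht)) (hrs.trans hst)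
    | right_lt hs'' => exact absurd hs'' hs'
    | right_eq hs'' => exact absurd hs'' hs'
  | right_lt hr hs h =>
    cases h' with
    | missing _ ht h' hst =>
      have ht' := h'.resolve_left (not_not_intro hs)
      exact .missing (mem_of_mem_succ hr) ht (.inr ht') (row_lt_of_mem_of_notMem hr ht')
    | right_lt _ ht h' => exact .right_lt hr ht (h.trans h')
    | right_eq _ ht h' => exact .right_lt hr ht (h.trans_eq h')
  | right_eq hr hs h hrs ih =>
    cases h' with
    | missing _ ht h' hst =>
      have ht' := h'.resolve_left (not_not_intro hs)
      exact .missing (mem_of_mem_succ hr) ht (.inr ht') (row_lt_of_mem_of_notMem hr ht')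
    | right_lt _ ht h' => exact .right_lt hr ht (h.trans_lt h')
    | right_eq _ ht h' hst => exact .right_eq hr ht (h.trans h') (ih hst)

/-- Equal right neighbours defer the comparison by one column; this ends because the diagram has
finitely many columns. -/
theorem trichotomous (τ : InvertedTableau lam) (hr : (r, c) ∈ lam) (hs : (s, c) ∈ lam)
    (hne : r ≠ s) : τ.HeightLT c r s ∨ τ.HeightLT c s r := by
  obtain ⟨n, hn⟩ := exists_le_add_of_mem lam c
  induction n generalizing c with
  | zero => exact absurd hr (hn r c le_rfl)
  | succ n ih =>
    by_cases hm : (r, c + 1) ∈ lam ∧ (s, c + 1) ∈ lam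
    · obtain ⟨hr', hs'⟩ := hm
      rcases lt_trichotomy (τ.entry r (c + 1)) (τ.entry s (c + 1)) with h | h | h
      · exact .inl (.right_lt hr' hs' h)
      · rcases ih hr' hs' fun r c' hc => hn r c' (by omega) with h' | h'
        · exact .inl (.right_eq hr' hs' h h')
        · exact .inr (.right_eq hs' hr' h.symm h')
      · exact .inr (.right_lt hs' hr' h)
    · rw [not_and_or] at hm
      rcases lt_or_gt_of_ne hne with h | h
      · exact .inl (.missing hr hs hm h)
      · exact .inr (.missing hs hr hm.symm h)

/-- The height order on a column depends only on the columns to the right of it. -/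
theorem of_entry_eq {τ' : InvertedTableau lam} (h : τ.HeightLT c r s)
    (he : ∀ r d, c < d → τ.entry r d = τ'.entry r d) : τ'.HeightLT c r s := by
  induction h with
  | missing hr hs h hrs => exact .missing hr hs h hrs
  | right_lt hr hs h =>
    exact .right_lt hr hs (by rwa [← he _ _ (Nat.lt_succ_self _), ← he _ _ (Nat.lt_succ_self _)])
  | right_eq hr hs h hrs ih =>
    exact .right_eq hr hs (by rwa [← he _ _ (Nat.lt_succ_self _), ← he _ _ (Nat.lt_succ_self _)])
      (ih fun r d hd => he r d (Nat.lt_of_succ_lt hd))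

end HeightLT

/-- An inversion pair is a pair of entries of a column whose height order is opposite to the order
of their values. -/
theorem isInversionPair_iff {c r s : ℕ} :
    τ.IsInversionPair c r s ↔ τ.entry r c < τ.entry s c ∧ τ.HeightLT c s r := by
  constructor
  · rintro ⟨hr, hs, hlt, n, hn, hend⟩
    refine ⟨hlt, ?_⟩
    -- The inequality must not enter the induction: in the inductive step the entries in column `c +
    -- 1` are equal.
    clear hlt
    induction n generalizing c with
    | zero =>
      rcases hend with ⟨hm, hsr⟩ | ⟨hr', hs', h⟩
      · exact .missing hs hr hm.symm hsr
      · exact .right_lt hs' hr' h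
    | succ n ih =>
      obtain ⟨hr', hs', he⟩ := hn 1 le_rfl (by omega)
      refine .right_eq hs' hr' he.symm (ih hr' hs' (fun k hk hkn => ?_) ?_)
      · have := hn (k + 1) (by omega) (by omega)
        rwa [show c + 1 + k = c + (k + 1) by ring]
      · rwa [show c + 1 + (n + 1) = c + (n + 1 + 1) by ring]
  · rintro ⟨hlt, h⟩
    refine ⟨h.mem_right, h.mem_left, hlt, ?_⟩
    clear hlt
    induction h with
    | missing hr hs h hrs => exact ⟨0, by intros; omega, .inl ⟨h.symm, hrs⟩⟩
    | right_lt hr hs h => exact ⟨0, by intros; omega, .inr ⟨hs, hr, h⟩⟩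
    | @right_eq c s r hs hr he h ih =>
      obtain ⟨n, hn, hend⟩ := ih
      refine ⟨n + 1, fun k hk hkn => ?_, ?_⟩
      · obtain rfl | hk := eq_or_lt_of_le hk
        · exact ⟨hr, hs, he.symm⟩
        · have := hn (k - 1) (by omega) (by omega)
          rwa [show c + 1 + (k - 1) = c + k by omega] at this
      · rwa [show c + 1 + (n + 1) = c + (n + 1 + 1) by ring] at hend

/-! ### Identifications obtained by ranking -/

open Classical in
/-- Ranking the entries of each column by value, and equal values by a strict total order on the
rows of the column, gives an identification. -/
theorem isIdentification_of_rank {R : ℕ → ℕ → ℕ → Prop}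
    (hne : ∀ {c r s}, R c r s → r ≠ s)
    (htrans : ∀ {c r s t}, R c r s → R c s t → R c r t)
    (htri : ∀ {c r s}, (r, c) ∈ lam → (s, c) ∈ lam → r ≠ s → R c r s ∨ R c s r)
    {φ : ℕ → ℕ → ℕ}
    (hφ : ∀ c r, φ c r = ((Finset.range (lam.colLen c)).filter fun x =>
      τ.entry x c < τ.entry r c ∨ (τ.entry x c = τ.entry r c ∧ R c x r)).card) :
    τ.IsIdentification φ := by
  intro c
  have hlt : ∀ r s, (r, c) ∈ lam →
      τ.entry r c < τ.entry s c ∨ (τ.entry r c = τ.entry s c ∧ R c r s) → φ c r < φ c s := by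
    intro r s hr h
    rw [hφ, hφ]
    refine Finset.card_lt_card (Finset.ssubset_iff_of_subset ?_ |>.2 ⟨r, ?_, ?_⟩)
    · intro x hx
      simp only [Finset.mem_filter] at hx ⊢
      refine ⟨hx.1, ?_⟩
      rcases hx.2 with h₁ | ⟨h₁, h₁'⟩ <;> rcases h with h₂ | ⟨h₂, h₂'⟩
      · exact .inl (h₁.trans h₂)
      · exact .inl (h₁.trans_eq h₂)
      · exact .inl (h₁.trans_lt h₂)
      · exact .inr ⟨h₁.trans h₂, htrans h₁' h₂'⟩
    · simpa only [Finset.mem_filter, Finset.mem_range] using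
        ⟨YoungDiagram.mem_iff_lt_colLen.1 hr, h⟩
    · simp only [Finset.mem_filter, not_and, not_or]
      exact fun _ => ⟨lt_irrefl _, fun _ h => hne h rfl⟩
  have hmaps : ∀ r, (r, c) ∈ lam → (φ c r, c) ∈ lam := by
    intro r hr
    rw [YoungDiagram.mem_iff_lt_colLen, hφ]
    refine lt_of_lt_of_eq (Finset.card_lt_card (Finset.ssubset_iff_of_subset
      (Finset.filter_subset _ _) |>.2 ⟨r, ?_, ?_⟩)) (Finset.card_range _)
    · exact Finset.mem_range.2 (YoungDiagram.mem_iff_lt_colLen.1 hr)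
    · simp only [Finset.mem_filter, not_and, not_or]
      exact fun _ => ⟨lt_irrefl _, fun _ h => hne h rfl⟩
  have hinj : ∀ r s, (r, c) ∈ lam → (s, c) ∈ lam → φ c r = φ c s → r = s := by
    intro r s hr hs he
    by_contra hrs
    rcases lt_trichotomy (τ.entry r c) (τ.entry s c) with h | h | h
    · exact (hlt r s hr (.inl h)).ne he
    · rcases htri hr hs hrs with h' | h'
      · exact (hlt r s hr (.inr ⟨h, h'⟩)).ne he
      · exact (hlt s r hs (.inr ⟨h.symm, h'⟩)).ne he.symm
    · exact (hlt s r hs (.inl h)).ne he.symm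
  have hfin : {r | (r, c) ∈ lam}.Finite :=
    (Set.finite_lt_nat (lam.colLen c)).subset fun r hr => YoungDiagram.mem_iff_lt_colLen.1 hr
  refine ⟨(Set.Finite.injOn_iff_bijOn_of_mapsTo hfin hmaps).1
    fun r hr s hs => hinj r s hr hs, fun r hr => ?_⟩
  have hmem : ∀ i : Fin (lam.colLen c), ((i : ℕ), c) ∈ lam := fun i =>
    YoungDiagram.mem_iff_lt_colLen.2 i.2
  let u : Fin (lam.colLen c) → Fin (lam.colLen c) := fun i =>
    ⟨φ c i, YoungDiagram.mem_iff_lt_colLen.1 (hmaps i (hmem i))⟩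
  have hu : Function.Injective u := fun i j hij =>
    Fin.ext (hinj i j (hmem i) (hmem j) (congrArg Fin.val hij))
  let e : Equiv.Perm (Fin (lam.colLen c)) :=
    Equiv.ofBijective u (Finite.injective_iff_bijective.1 hu)
  -- Placing each entry at its rank sorts the column, and a tuple has only one weakly increasing
  -- rearrangement.
  have hmono : Monotone (τ.column c ∘ e.symm) := by
    intro i j hij
    by_contra! h
    have h' := hlt _ _ (hmem (e.symm j)) (.inl h)
    have h'' : e (e.symm j) < e (e.symm i) := h'
    rw [e.apply_symm_apply, e.apply_symm_apply] at h''
    exact absurd hij (not_le.2 h'')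
  have hsort := Tuple.unique_monotone (Tuple.monotone_sort (τ.column c)) hmono
  have hr' := YoungDiagram.mem_iff_lt_colLen.1 hr
  have hval := congrFun hsort (e ⟨r, hr'⟩)
  simp only [Function.comp_apply, Equiv.symm_apply_apply] at hval
  exact (τ.sortedEntry_of_lt (e ⟨r, hr'⟩).2).trans hval

theorem isIdentification_readingIdentification :
    τ.IsIdentification τ.readingIdentification := by
  refine τ.isIdentification_of_rank (R := fun _ r s => r < s) (fun h => h.ne)
    (fun h h' => h.trans h') (fun _ _ h => lt_or_gt_of_ne h) fun c r => ?_
  unfold readingIdentification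
  congr

theorem isIdentification_heightIdentification :
    τ.IsIdentification τ.heightIdentification :=
  τ.isIdentification_of_rank (R := τ.HeightLT) HeightLT.ne HeightLT.trans
    (HeightLT.trichotomous τ) fun _ _ => rfl

/-! ### Recovering the columns from right to left -/

variable {τ} {τ' : InvertedTableau lam} {φ φ' : ℕ → ℕ → ℕ}

theorem mem_entryInversions_iff (hφ : τ.IsIdentification φ) {c r s : ℕ} (hr : (r, c) ∈ lam)
    (hs : (s, c) ∈ lam) :
    ((φ c r, c), (φ c s, c)) ∈ τ.entryInversions φ ↔ τ.IsInversionPair c r s := by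
  constructor
  · rintro ⟨c', r', s', h, e⟩
    simp only [Prod.mk.injEq] at e
    obtain ⟨⟨er, rfl⟩, es, -⟩ := e
    rwa [(hφ c).1.injOn hr h.1 er, (hφ c).1.injOn hs h.2.1 es]
  · exact fun h => ⟨c, r, s, h, rfl⟩

/-- A column is determined by the columns to the right of it, the standardization and the
entry-specific inversion pairs. -/
theorem entry_eq_of_right (hst : τ.st = τ'.st) (hφ : τ.IsIdentification φ)
    (hφ' : τ'.IsIdentification φ') (h : τ.entryInversions φ = τ'.entryInversions φ') {c : ℕ}
    (he : ∀ r d, c < d → τ.entry r d = τ'.entry r d) {r : ℕ} (hr : (r, c) ∈ lam) :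
    τ.entry r c = τ'.entry r c := by
  classical
  let α := {r // (r, c) ∈ lam}
  have : Finite α :=
    (Set.finite_lt_nat (lam.colLen c)).subset fun r hr => YoungDiagram.mem_iff_lt_colLen.1 hr
  let R : α → α → Prop := fun a b => τ.HeightLT c a b
  have : IsStrictTotalOrder α R :=
    { trichotomous := fun a b hab hba => by
        by_contra hne
        rcases HeightLT.trichotomous τ a.2 b.2 fun e => hne (Subtype.ext e) with h | h
        · exact hab h
        · exact hba h
      irrefl := fun a h => h.ne rfl
      trans := fun a b d h h' => h.trans h' }
  let _ : LinearOrder α := linearOrderOfSTO R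
  let θ₁ : Equiv.Perm α := (hφ c).1.equiv
  let θ₂ : Equiv.Perm α := (hφ' c).1.equiv
  -- `θ` matches the entries of `τ` and `τ'` that are sent to the same box of the common
  -- standardization.
  let θ : Equiv.Perm α := θ₁.trans θ₂.symm
  have hθφ : ∀ a : α, φ' c (θ a) = φ c a := fun a =>
    congrArg Subtype.val (θ₂.apply_symm_apply (θ₁ a))
  have hθ : ∀ a : α, τ'.entry (θ a) c = τ.entry a c := fun a => by
    rw [← (hφ' c).2 _ (θ a).2, ← (hφ c).2 _ a.2, hθφ, hst]
  have key := eq_of_perm_of_forall_lt_iff (f := fun a : α => τ.entry a c)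
    (g := fun a : α => τ'.entry a c) θ hθ ?_
  · exact congrFun key ⟨r, hr⟩
  · intro a b hab
    have h₁ : τ.IsInversionPair c a b ↔ τ'.IsInversionPair c (θ a) (θ b) := by
      rw [← mem_entryInversions_iff hφ a.2 b.2, ← mem_entryInversions_iff hφ' (θ a).2 (θ b).2,
        hθφ, hθφ, h]
    rw [isInversionPair_iff, isInversionPair_iff, hθ, hθ, and_congr_right_iff] at h₁
    -- The order on `α` is the height order of `τ`; it is also that of `τ'`, as the columns to the
    -- right agree.
    exact (h₁ hab).trans ⟨fun h => h.of_entry_eq fun r d hd => (he r d hd).symm,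
      fun h => h.of_entry_eq he⟩

theorem eq_of_entryInversions_eq (hst : τ.st = τ'.st) (hφ : τ.IsIdentification φ)
    (hφ' : τ'.IsIdentification φ') (h : τ.entryInversions φ = τ'.entryInversions φ') :
    τ = τ' := by
  refine ext_entry fun r c => ?_
  obtain ⟨n, hn⟩ := exists_le_add_of_mem lam c
  -- Strengthened to all columns from `c` on, since a column is recovered from all those to its
  -- right.
  suffices ∀ d, c ≤ d → τ.entry r d = τ'.entry r d from this c le_rfl
  induction n generalizing c r with
  | zero => exact fun d hd => by rw [τ.zeros _ _ (hn r d hd), τ'.zeros _ _ (hn r d hd)]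
  | succ n ih =>
    have ih' : ∀ r d, c < d → τ.entry r d = τ'.entry r d := fun r d hd =>
      ih r (c + 1) (fun r c' hc => hn r c' (by omega)) d hd
    intro d hd
    obtain rfl | hd := eq_or_lt_of_le hd
    · by_cases hr : (r, c) ∈ lam
      · exact entry_eq_of_right hst hφ hφ' h ih' hr
      · rw [τ.zeros _ _ hr, τ'.zeros _ _ hr]
    · exact ih' r d hd

end InvertedTableau

end YoungInversion

theorem mainTheorem2 (lam : YoungDiagram) (τ τ' : YoungInversion.InvertedTableau lam)
    (hst : τ.st = τ'.st) :
    (τ.entryInversions τ.readingIdentification = τ'.entryInversions τ'.readingIdentification →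
      τ = τ') ∧
    (τ.entryInversions τ.heightIdentification = τ'.entryInversions τ'.heightIdentification →
      τ = τ') ∧
    (∀ φ φ' : ℕ → ℕ → ℕ, τ.IsIdentification φ → τ'.IsIdentification φ' →
      τ.entryInversions φ = τ'.entryInversions φ' → τ = τ') := by
  open YoungInversion.InvertedTableau in
  exact ⟨eq_of_entryInversions_eq hst (isIdentification_readingIdentification τ)
      (isIdentification_readingIdentification τ'),
    eq_of_entryInversions_eq hst (isIdentification_heightIdentification τ)
      (isIdentification_heightIdentification τ'),
    fun _ _ hφ hφ' => eq_of_entryInversions_eq hst hφ hφ'⟩
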